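/- **Theorem 3 (Consistency of the Quick Shift cluster tree).** Let $d\ge 1$ and let $f:\mathbb{R}^d\to[0,\infty)$ be a continuous probability density (with respect to Lebesgue measure) with compact support $\mathcal{X}$, such that $|f(x)-f(x')|\le C_\alpha\|x-x'\|^\alpha$ for all $x,x'\in\mathcal{X}$, where $0<\alpha\le 1$ and $C_\alpha>0$. Let $K:\mathbb{R}^d\to[0,\infty)$ satisfy $\int K=1$ and $K(u)=k(\|u\|)$ with $k:[0,\infty)\to[0,\infty)$ non-increasing and $k(t)\le C_\rho\exp(-t^\rho)$ for all $t>t_0$, for some $\rho,C_\rho,t_0>0$. Let $h=h(n)>0$ and $\tau=\tau(n)>0$ satisfy, as $n\to\infty$, $h\to 0$, $\log n/(nh^d)\to 0$, $\tau\to 0$, and $\tau(n)\ge(\log^2 n/n)^{1/d}$ for all $n\ge 1$. Let $x_1,\dots,x_n$ be i.i.d. samples from $f$, $X_{[n]}=\{x_1,\dots,x_n\}$, and $\widehat f_h(x)=\frac{1}{nh^d}\sum_{i=1}^n K\big(\frac{x-x_i}{h}\big)$. The Quick Shift graph $G$ is the directed graph on $X_{[n]}$ in which every $x_i$ for which some $x\in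 X_{[n]}$ has $\widehat f_h(x)>\widehat f_h(x_i)$ and $\|x-x_i\|\le\tau$ has exactly one outgoing edge, to a closest point of $\{x_j:\widehat f_h(x_j)>\widehat f_h(x_i)\}$ (ties broken arbitrarily), and in which there are no other edges. For $\lambda>0$ let $\tilde G(\lambda)$ be the collection of vertex sets of the connected components (edge directions ignored) of the subgraph of $G$ induced on $\{x\in X_{[n]}:\widehat f_h(x)>\lambda\}$. Let $\widehat C_f(\lambda)$ be the result of repeatedly replacing in $\tilde G(\lambda)$ two distinct sets $A_1,A_2$ with $\inf_{a_1\in A_1,a_2\in A_2}\|a_1-a_2\|<\tau$ by $A_1\cup A_2$, until no such pair is left. The cluster tree of $f$ is $C_f(\lambda)$, the collection of connected components of $\{x\in\mathcal{X}:f(x)\ge\lambda\}$, $\lambda\in\mathbb{R}$. For a collection of clusters $\mathcal{C}$ with a height function $g\ge 0$ let $m_{\mathcal{C},g}(x,x')=\sup\{\inf_C g: C\in\mathcal{C},\ x,x'\in C\}$ be the merge height (with $\sup\emptyset=0$). The merge distortion of $(\mathcal{C}_1,g_1)$ and $(\mathcal{C}_2,g_2)$ on $X_{[n]}$ is $\max_{x,x'\in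 X_{[n]}}|m_{\mathcal{C}_1,g_1}(x,x')-m_{\mathcal{C}_2,g_2}(x,x')|$. Then $\widehat C_f$ converges in probability to the cluster tree of $f$ in merge distortion: as $n\to\infty$, the merge distortion on $X_{[n]}$ between $\big(\bigcup_{\lambda} C_f(\lambda),f\big)$ and $\big(\bigcup_{\lambda>0}\widehat C_f(\lambda),f\big)$ tends to $0$ in probability. The same holds when the estimated tree carries the heights given by $\widehat f_h$, i.e. with $\big(\bigcup_{\lambda>0}\widehat C_f(\lambda),\widehat f_h\big)$ in place of $\big(\bigcup_{\lambda>0}\widehat C_f(\lambda),f\big)$. -/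

import Mathlib

open Filter Topology MeasureTheory ProbabilityTheory
open scoped ENNReal NNReal

noncomputable section

/-- `ℝ^d` with its Euclidean norm and Lebesgue measure. -/
abbrev Rd (d : ℕ) : Type := EuclideanSpace ℝ (Fin d)

/-! ### Densities, level sets and the cluster tree -/

/-- The superlevel set of `f` at level `l`, inside the (closed) support of `f`. -/
def levelSet {d : ℕ} (f : Rd d → ℝ) (l : ℝ) : Set (Rd d) :=
  {x | x ∈ tsupport f ∧ l ≤ f x}

/-- The cluster tree of `f`: each level is sent to the collection of the connected components of
the level set. -/
def clusterTree {d : ℕ} (f : Rd d → ℝ) (l : ℝ) : Set (Set (Rd d)) :=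
  {A | ∃ x ∈ levelSet f l, A = connectedComponentIn (levelSet f l) x}

/-! ### Kernel density estimation -/

/-- `K` is a kernel on `ℝ^d`: it integrates to one, and it is spherically symmetric with a
non-increasing profile `k : [0,∞) → [0,∞)` that decays exponentially. -/
structure IsRadialKernel {d : ℕ} (K : Rd d → ℝ) : Prop where
  integral_eq_one : ∫ u, K u = 1
  exists_profile : ∃ k : ℝ≥0 → ℝ≥0, Antitone k ∧ (∀ u, K u = k ‖u‖₊) ∧
    ∃ ρ C t₀ : ℝ, 0 < ρ ∧ 0 < C ∧ 0 < t₀ ∧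
      ∀ t : ℝ≥0, t₀ < t → (k t : ℝ) ≤ C * Real.exp (-((t : ℝ) ^ ρ))

/-- The kernel density estimator with kernel `K` and bandwidth `h` from the sample
`x 0, …, x (n - 1)`. -/
def kde {d : ℕ} (K : Rd d → ℝ) (h : ℝ) (n : ℕ) (x : Fin n → Rd d) (y : Rd d) : ℝ :=
  1 / (n * h ^ d) * ∑ i, K (h⁻¹ • (y - x i))

/-! ### Quick Shift -/

/-- `G` is an output of Quick Shift on the set of points `S`, with empirical density `g` and
segmentation parameter `τ`. A point of `S` that has a point of higher empirical density
within distance `τ` gets exactly one outgoing edge, to a nearest point of `S` of higher empirical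
density (ties are broken arbitrarily). There are no other edges. -/
structure IsQuickShiftGraph {d : ℕ} (S : Set (Rd d)) (g : Rd d → ℝ) (τ : ℝ)
    (G : Digraph (Rd d)) : Prop where
  source : ∀ x y, G.Adj x y → x ∈ S ∧ ∃ z ∈ S, g x < g z ∧ ‖z - x‖ ≤ τ
  target : ∀ x y, G.Adj x y →
    y ∈ S ∧ g x < g y ∧ ∀ z ∈ S, g x < g z → ‖x - y‖ ≤ ‖x - z‖
  exists_edge : ∀ x ∈ S, (∃ z ∈ S, g x < g z ∧ ‖z - x‖ ≤ τ) → ∃ y, G.Adj x y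
  unique_edge : ∀ x y y', G.Adj x y → G.Adj x y' → y = y'

/-- The points of `S` of empirical density above `l`, with the edges of `G` between them
(directions forgotten). -/
def levelGraph {d : ℕ} (S : Set (Rd d)) (g : Rd d → ℝ) (G : Digraph (Rd d)) (l : ℝ) :
    SimpleGraph {x : Rd d // x ∈ S ∧ l < g x} :=
  SimpleGraph.fromRel fun x y => G.Adj x y

/-- The vertex sets of the connected components of `levelGraph S g G l`. -/
def levelComponents {d : ℕ} (S : Set (Rd d)) (g : Rd d → ℝ) (G : Digraph (Rd d)) (l : ℝ) :
    Set (Set (Rd d)) :=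
  {A | ∃ c : (levelGraph S g G l).ConnectedComponent, A = Subtype.val '' c.supp}

/-! ### Linkage -/

/-- One linkage step: two distinct members of the collection `𝒜` at distance less than `δ` are
removed and replaced by their union. -/
def LinkStep {d : ℕ} (δ : ℝ) (𝒜 ℬ : Set (Set (Rd d))) : Prop :=
  ∃ A₁ ∈ 𝒜, ∃ A₂ ∈ 𝒜, A₁ ≠ A₂ ∧
    (⨅ a₁ ∈ A₁, ⨅ a₂ ∈ A₂, edist a₁ a₂) < ENNReal.ofReal δ ∧
    ℬ = (𝒜 \ {A₁, A₂}) ∪ {A₁ ∪ A₂}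

/-- `ℬ` is a result of repeating linkage steps from `𝒜` until no further step is possible. -/
def IsLink {d : ℕ} (δ : ℝ) (𝒜 ℬ : Set (Set (Rd d))) : Prop :=
  Relation.ReflTransGen (LinkStep δ) 𝒜 ℬ ∧ ∀ 𝒟, ¬ LinkStep δ ℬ 𝒟

/-- `T` is an output of the Quick Shift cluster tree estimator: for every level `l > 0`, `T l` is
the `τ`-linkage of the components of the Quick Shift graph restricted to the level `l`. -/
def IsQuickShiftClusterTree {d : ℕ} (S : Set (Rd d)) (g : Rd d → ℝ) (τ : ℝ)
    (T : ℝ → Set (Set (Rd d))) : Prop :=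
  ∃ G : Digraph (Rd d), IsQuickShiftGraph S g τ G ∧
    ∀ l : ℝ, 0 < l → IsLink τ (levelComponents S g G l) (T l)

/-! ### Merge distortion -/

/-- The merge height of `x` and `y` in the collection of clusters `𝒞` with the height function
`g ≥ 0`: the supremum, over the clusters `C` that contain both points, of the height `inf_C g`
of `C`. It is `0`, the least possible height, if no cluster contains both points. -/
def mergeHeight {d : ℕ} (𝒞 : Set (Set (Rd d))) (g : Rd d → ℝ) (x y : Rd d) : ℝ :=
  sSup {t | ∃ C ∈ 𝒞, x ∈ C ∧ y ∈ C ∧ t = sInf (g '' C)}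

/-- The merge distortion, over the finite set of points `S`, between the collections of clusters
`𝒞₁` and `𝒞₂`, equipped with the height functions `g₁` and `g₂`: the maximal difference of the
merge heights of pairs of points of `S` (`0` if `S` is empty). -/
def mergeDistortion {d : ℕ} (S : Set (Rd d)) (𝒞₁ : Set (Set (Rd d))) (g₁ : Rd d → ℝ)
    (𝒞₂ : Set (Set (Rd d))) (g₂ : Rd d → ℝ) : ℝ :=
  sSup {t | ∃ x ∈ S, ∃ y ∈ S, t = |mergeHeight 𝒞₁ g₁ x y - mergeHeight 𝒞₂ g₂ x y|}

/-- The first `n` points of a sequence of random points. -/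
def sample {Ω : Type*} {d : ℕ} (X : ℕ → Ω → Rd d) (n : ℕ) (ω : Ω) : Fin n → Rd d :=
  fun i => X i ω

end

/-!
The proof separates a deterministic estimate from two probabilistic ones.

Fix `ε > 0` and suppose that the empirical density differs from `f` by at most `ε` at every sample
point, that `f` varies by at most `ε` over distances up to `τ`, and that every `y` with `f y ≥ ε`
has a sample point within `τ / 4`. Then the merge distortion is at most `5ε`
(`mergeDistortion_le`). In one direction, every edge of the Quick Shift graph has length at most
`τ`, so two points of an estimated cluster are joined by a polygonal line through the cluster, on
which `f` stays above the height of the cluster minus `2ε` (`mergeHeight_le_clusterTree`). In the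
other direction, along a connected set on which `f ≥ v` the nearby sample points have empirical
density above `v - 3ε` and consecutive ones are less than `τ` apart, so linkage puts them into one
cluster (`clusterTree_mergeHeight_le`). Of the Quick Shift graph only the bound on the length of
its edges matters. The heights of the estimated tree enter through a function `φ` that is within
`ε` of `f` at the sample points, which covers `f` and the kernel density estimator at once.

Only the values of the kernel density estimator at the sample points play a role, so no uniform
bound over a class of sets is needed. The contribution of the evaluation point itself is `O(1)`
in the unnormalized sum; given that point, the remaining terms are independent, bounded, and of
variance `O(h ^ d)`, so Bernstein's inequality bounds the probability of a deviation by
`2 exp (-c n h ^ d)`, and a union bound over the `n` points suffices because `log n = o(n h ^ d)`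
(`tendsto_measure_exists_abs_kde_sub_gt`). The bias vanishes by uniform continuity of `f`.

A ball of radius `τ / 12` about a point with `f ≥ ε` has mass at least a constant times
`τ ^ d`, hence at least `q = c log ^ 2 n / n`. A maximal separated set of such points has at most
`1 / q` elements, and each ball is missed by the sample with probability at most `exp (-n q)`;
the product tends to `0` (`tendsto_measure_exists_forall_dist_gt`).
-/

/-! ### Chain-connected clusters -/

/-- A set is chain connected at scale `δ` if any two of its points are joined by a finite sequence
of points of the set with consecutive distances at most `δ`. -/
def IsChainConnected {E : Type*} [PseudoMetricSpace E] (δ : ℝ) (A : Set E) : Prop :=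
  ∀ x ∈ A, ∀ y ∈ A, Relation.ReflTransGen (fun a b => a ∈ A ∧ b ∈ A ∧ dist a b ≤ δ) x y

theorem IsChainConnected.union {E : Type*} [PseudoMetricSpace E] {δ : ℝ} {A B : Set E}
    (hA : IsChainConnected δ A) (hB : IsChainConnected δ B)
    {a b : E} (ha : a ∈ A) (hb : b ∈ B) (hab : dist a b ≤ δ) : IsChainConnected δ (A ∪ B) := by
  have hA' : ∀ x ∈ A, ∀ y ∈ A, Relation.ReflTransGen
      (fun p q => p ∈ A ∪ B ∧ q ∈ A ∪ B ∧ dist p q ≤ δ) x y := fun x hx y hy =>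
    Relation.ReflTransGen.mono (fun p q h => ⟨Or.inl h.1, Or.inl h.2.1, h.2.2⟩) _ _ (hA x hx y hy)
  have hB' : ∀ x ∈ B, ∀ y ∈ B, Relation.ReflTransGen
      (fun p q => p ∈ A ∪ B ∧ q ∈ A ∪ B ∧ dist p q ≤ δ) x y := fun x hx y hy =>
    Relation.ReflTransGen.mono (fun p q h => ⟨Or.inr h.1, Or.inr h.2.1, h.2.2⟩) _ _ (hB x hx y hy)
  rintro x (hx | hx) y (hy | hy)
  · exact hA' x hx y hy
  · exact ((hA' x hx a ha).tail ⟨Or.inl ha, Or.inr hb, hab⟩).trans (hB' b hb y hy)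
  · exact ((hB' x hx b hb).tail ⟨Or.inr hb, Or.inl ha, by rwa [dist_comm]⟩).trans (hA' a ha y hy)
  · exact hB' x hx y hy

/-- If all balls of radius `δ` about the points of a chain-connected set lie in `L`, then the
polygonal lines through its chains join its points inside `L`. -/
theorem IsChainConnected.connectedComponentIn_mem {d : ℕ} {δ : ℝ} {A L : Set (Rd d)}
    (hA : IsChainConnected δ A) (hδ : 0 ≤ δ) (hL : ∀ a ∈ A, ∀ z, dist z a ≤ δ → z ∈ L)
    {x y : Rd d} (hx : x ∈ A) (hy : y ∈ A) : y ∈ connectedComponentIn L x := by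
  have hxL : x ∈ L := hL x hx x (by simpa using hδ)
  induction hA x hx y hy with
  | refl => exact mem_connectedComponentIn hxL
  | @tail b c _ hbc ih =>
    have hb := ih hbc.1
    rw [connectedComponentIn_eq hb]
    refine (convex_segment b c).isPreconnected.subset_connectedComponentIn
      (left_mem_segment ℝ b c) (fun z hz => hL b hbc.1 z ?_) (right_mem_segment ℝ b c)
    have hball : segment ℝ b c ⊆ Metric.closedBall b δ :=
      (convex_closedBall b δ).segment_subset (Metric.mem_closedBall_self hδ)
        (by simpa [dist_comm] using hbc.2.2)
    exact hball hz

/-! ### The clusters of the Quick Shift tree -/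

theorem IsQuickShiftGraph.dist_le {d : ℕ} {S : Set (Rd d)} {g : Rd d → ℝ} {τ : ℝ}
    {G : Digraph (Rd d)} (hG : IsQuickShiftGraph S g τ G) {x y : Rd d} (h : G.Adj x y) :
    dist x y ≤ τ := by
  obtain ⟨z, hz, hgz, hzx⟩ := (hG.source x y h).2
  rw [dist_eq_norm]
  exact ((hG.target x y h).2.2 z hz hgz).trans (by rwa [norm_sub_rev])

theorem IsQuickShiftGraph.isChainConnected {d : ℕ} {S : Set (Rd d)} {g : Rd d → ℝ} {τ : ℝ}
    {G : Digraph (Rd d)} (hG : IsQuickShiftGraph S g τ G) {l : ℝ} {A : Set (Rd d)}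
    (hA : A ∈ levelComponents S g G l) : IsChainConnected τ A := by
  obtain ⟨c, rfl⟩ := hA
  rintro _ ⟨x, hx, rfl⟩ _ ⟨y, hy, rfl⟩
  have hxy : (levelGraph S g G l).Reachable x y :=
    SimpleGraph.ConnectedComponent.exact (hx.trans hy.symm)
  rw [SimpleGraph.reachable_iff_reflTransGen] at hxy
  clear hy
  induction hxy with
  | refl => exact Relation.ReflTransGen.refl
  | @tail b b' hb hbb' ih =>
    have hb_mem : b ∈ c.supp := by
      rw [← SimpleGraph.reachable_iff_reflTransGen] at hb
      exact (SimpleGraph.ConnectedComponent.sound hb).symm.trans hx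
    have hb'_mem : b' ∈ c.supp :=
      (SimpleGraph.ConnectedComponent.sound hbb'.reachable).symm.trans hb_mem
    refine ih.tail ⟨⟨b, hb_mem, rfl⟩, ⟨b', hb'_mem, rfl⟩, ?_⟩
    rcases (SimpleGraph.fromRel_adj _ _ _).1 hbb' with ⟨-, h | h⟩
    · exact hG.dist_le h
    · exact dist_comm (b : Rd d) b' ▸ hG.dist_le h

theorem sUnion_levelComponents {d : ℕ} (S : Set (Rd d)) (g : Rd d → ℝ) (G : Digraph (Rd d))
    (l : ℝ) : ⋃₀ levelComponents S g G l = {x | x ∈ S ∧ l < g x} := by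
  ext x
  constructor
  · rintro ⟨_, ⟨c, rfl⟩, ⟨y, _, rfl⟩⟩
    exact y.2
  · intro hx
    exact ⟨_, ⟨(levelGraph S g G l).connectedComponentMk ⟨x, hx⟩, rfl⟩, ⟨x, hx⟩, rfl, rfl⟩

theorem exists_dist_lt_of_iInf_edist_lt {d : ℕ} {δ : ℝ} {A₁ A₂ : Set (Rd d)}
    (h : (⨅ a₁ ∈ A₁, ⨅ a₂ ∈ A₂, edist a₁ a₂) < ENNReal.ofReal δ) :
    ∃ a₁ ∈ A₁, ∃ a₂ ∈ A₂, dist a₁ a₂ < δ := by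
  simp only [iInf_lt_iff] at h
  obtain ⟨a₁, h₁, a₂, h₂, h⟩ := h
  exact ⟨a₁, h₁, a₂, h₂, by rw [edist_dist] at h; exact ENNReal.ofReal_lt_ofReal_iff'.1 h |>.1⟩

theorem LinkStep.isChainConnected {d : ℕ} {δ : ℝ} {𝒜 ℬ : Set (Set (Rd d))}
    (h : LinkStep δ 𝒜 ℬ) (h𝒜 : ∀ A ∈ 𝒜, IsChainConnected δ A) :
    ∀ B ∈ ℬ, IsChainConnected δ B := by
  obtain ⟨A₁, h₁, A₂, h₂, -, hlt, rfl⟩ := h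
  rintro B (hB | rfl)
  · exact h𝒜 B hB.1
  · obtain ⟨a₁, ha₁, a₂, ha₂, hd⟩ := exists_dist_lt_of_iInf_edist_lt hlt
    exact (h𝒜 A₁ h₁).union (h𝒜 A₂ h₂) ha₁ ha₂ hd.le

theorem LinkStep.sUnion_eq {d : ℕ} {δ : ℝ} {𝒜 ℬ : Set (Set (Rd d))}
    (h : LinkStep δ 𝒜 ℬ) : ⋃₀ ℬ = ⋃₀ 𝒜 := by
  obtain ⟨A₁, h₁, A₂, h₂, -, -, rfl⟩ := h
  ext x
  constructor
  · rintro ⟨B, hB | rfl, hx⟩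
    · exact ⟨B, hB.1, hx⟩
    · exact hx.elim (fun hx => ⟨A₁, h₁, hx⟩) fun hx => ⟨A₂, h₂, hx⟩
  · rintro ⟨B, hB, hx⟩
    by_cases hB₁ : B = A₁
    · exact ⟨_, Or.inr rfl, Or.inl (hB₁ ▸ hx)⟩
    by_cases hB₂ : B = A₂
    · exact ⟨_, Or.inr rfl, Or.inr (hB₂ ▸ hx)⟩
    exact ⟨B, Or.inl ⟨hB, by simp [hB₁, hB₂]⟩, hx⟩

theorem IsLink.isChainConnected {d : ℕ} {δ : ℝ} {𝒜 ℬ : Set (Set (Rd d))} (h : IsLink δ 𝒜 ℬ)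
    (h𝒜 : ∀ A ∈ 𝒜, IsChainConnected δ A) : ∀ B ∈ ℬ, IsChainConnected δ B := by
  obtain ⟨h, -⟩ := h
  induction h with
  | refl => exact h𝒜
  | tail _ hstep ih => exact hstep.isChainConnected ih

theorem IsLink.sUnion_eq {d : ℕ} {δ : ℝ} {𝒜 ℬ : Set (Set (Rd d))} (h : IsLink δ 𝒜 ℬ) :
    ⋃₀ ℬ = ⋃₀ 𝒜 := by
  obtain ⟨h, -⟩ := h
  induction h with
  | refl => rfl
  | tail _ hstep ih => exact hstep.sUnion_eq.trans ih

theorem IsLink.eq_of_dist_lt {d : ℕ} {δ : ℝ} {𝒜 ℬ : Set (Set (Rd d))} (h : IsLink δ 𝒜 ℬ)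
    {B₁ B₂ : Set (Rd d)} (h₁ : B₁ ∈ ℬ) (h₂ : B₂ ∈ ℬ) {b₁ b₂ : Rd d} (hb₁ : b₁ ∈ B₁)
    (hb₂ : b₂ ∈ B₂) (hd : dist b₁ b₂ < δ) : B₁ = B₂ := by
  by_contra hne
  refine h.2 _ ⟨B₁, h₁, B₂, h₂, hne, lt_of_le_of_lt (b := edist b₁ b₂) ?_ ?_, rfl⟩
  · exact (iInf₂_le b₁ hb₁).trans (iInf₂_le b₂ hb₂)
  · rw [edist_dist]
    exact (ENNReal.ofReal_lt_ofReal_iff (dist_nonneg.trans_lt hd)).2 hd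

/-! ### Merge heights -/

theorem mergeHeight_nonneg {d : ℕ} (𝒞 : Set (Set (Rd d))) {g : Rd d → ℝ} (hg : ∀ x, 0 ≤ g x)
    (x y : Rd d) : 0 ≤ mergeHeight 𝒞 g x y := by
  refine Real.sSup_nonneg ?_
  rintro _ ⟨C, -, -, -, rfl⟩
  exact Real.sInf_nonneg (by rintro _ ⟨z, -, rfl⟩; exact hg z)

theorem le_mergeHeight {d : ℕ} {𝒞 : Set (Set (Rd d))} {g : Rd d → ℝ} (hg : ∀ x, 0 ≤ g x)
    {x y : Rd d} {C : Set (Rd d)} (hC : C ∈ 𝒞) (hx : x ∈ C) (hy : y ∈ C) {v : ℝ}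
    (hv : ∀ z ∈ C, v ≤ g z) : v ≤ mergeHeight 𝒞 g x y := by
  have hle : v ≤ sInf (g '' C) :=
    le_csInf ⟨_, x, hx, rfl⟩ (by rintro _ ⟨z, hz, rfl⟩; exact hv z hz)
  refine hle.trans (le_csSup ⟨g x, ?_⟩ ⟨C, hC, hx, hy, rfl⟩)
  rintro _ ⟨D, -, hxD, -, rfl⟩
  exact csInf_le ⟨0, by rintro _ ⟨z, -, rfl⟩; exact hg z⟩ ⟨x, hxD, rfl⟩

theorem mergeHeight_le {d : ℕ} {𝒞 : Set (Set (Rd d))} {g : Rd d → ℝ} (hg : ∀ x, 0 ≤ g x)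
    {x y : Rd d} {b : ℝ} (hb : 0 ≤ b)
    (h : ∀ C ∈ 𝒞, x ∈ C → y ∈ C → ∀ v, (∀ z ∈ C, v ≤ g z) → v ≤ b) :
    mergeHeight 𝒞 g x y ≤ b := by
  refine Real.sSup_le ?_ hb
  rintro _ ⟨C, hC, hx, hy, rfl⟩
  exact h C hC hx hy _ fun z hz =>
    csInf_le ⟨0, by rintro _ ⟨z, -, rfl⟩; exact hg z⟩ ⟨z, hz, rfl⟩

/-! ### Merge distortion under uniform approximation -/

/-- Lower bound for the density tree. The points of an estimated cluster are joined by steps of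
length at most `τ`, along which `f` drops by at most `ε` below the height of the cluster. -/
theorem mergeHeight_le_clusterTree {d : ℕ} {S : Set (Rd d)} {f g φ : Rd d → ℝ} {τ ε : ℝ}
    {T : ℝ → Set (Set (Rd d))} (hε : 0 ≤ ε) (hτ : 0 ≤ τ) (hf : ∀ x, 0 ≤ f x)
    (hφ : ∀ x, 0 ≤ φ x) (hφf : ∀ x ∈ S, |φ x - f x| ≤ ε)
    (hosc : ∀ x y, dist x y ≤ τ → |f x - f y| ≤ ε)
    (hT : IsQuickShiftClusterTree S g τ T) (x y : Rd d) :
    mergeHeight (⋃ l > (0 : ℝ), T l) φ x y ≤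
      mergeHeight (⋃ l : ℝ, clusterTree f l) f x y + 2 * ε := by
  have hm := mergeHeight_nonneg (⋃ l : ℝ, clusterTree f l) hf x y
  refine mergeHeight_le hφ (by positivity) ?_
  intro A hA hx hy v hv
  simp only [Set.mem_iUnion] at hA
  obtain ⟨l, hl, hA⟩ := hA
  obtain ⟨G, hG, hlink⟩ := hT
  have hchain := (hlink l hl).isChainConnected (fun B hB => hG.isChainConnected hB) A hA
  have hAS : ∀ z ∈ A, z ∈ S := fun z hz => by
    have hz' : z ∈ ⋃₀ T l := ⟨A, hA, hz⟩
    rw [(hlink l hl).sUnion_eq, sUnion_levelComponents] at hz'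
    exact hz'.1
  rcases le_or_gt v (2 * ε) with hle | hlt
  · linarith
  have hL : ∀ a ∈ A, ∀ z, dist z a ≤ τ → z ∈ levelSet f (v - 2 * ε) := by
    intro a ha z hz
    have h₁ := abs_le.1 (hosc z a hz)
    have h₂ := abs_le.1 (hφf a (hAS a ha))
    have h₃ := hv a ha
    have hfz : v - 2 * ε ≤ f z := by linarith
    -- as `v - 2 * ε` is positive, `z` lies in the support
    exact ⟨subset_tsupport f (Function.mem_support.2 (by linarith : (0 : ℝ) < f z).ne'), hfz⟩
  have hxL : x ∈ levelSet f (v - 2 * ε) := hL x hx x (by simpa using hτ)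
  suffices v - 2 * ε ≤ mergeHeight (⋃ l : ℝ, clusterTree f l) f x y by linarith
  have hmem : connectedComponentIn (levelSet f (v - 2 * ε)) x ∈ ⋃ l : ℝ, clusterTree f l :=
    Set.mem_iUnion.2 ⟨v - 2 * ε, x, hxL, rfl⟩
  exact le_mergeHeight hf hmem (mem_connectedComponentIn hxL) (hchain.connectedComponentIn_mem hτ hL hx hy)
    fun z hz => (connectedComponentIn_subset _ _ hz).2

/-- Upper bound for the density tree. The sample points near a connected set on which `f ≥ v` have
empirical density above `v - 3ε`; by connectedness they are joined by steps shorter than `τ`, so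
linkage puts them into one cluster. -/
theorem clusterTree_mergeHeight_le {d : ℕ} {S : Set (Rd d)} {f g φ : Rd d → ℝ} {τ ε : ℝ}
    {T : ℝ → Set (Set (Rd d))} (hε : 0 < ε) (hτ : 0 < τ) (hf : ∀ x, 0 ≤ f x)
    (hφ : ∀ x, 0 ≤ φ x) (hgf : ∀ x ∈ S, |g x - f x| ≤ ε) (hφf : ∀ x ∈ S, |φ x - f x| ≤ ε)
    (hosc : ∀ x y, dist x y ≤ τ → |f x - f y| ≤ ε)
    (hcov : ∀ y, ε ≤ f y → ∃ x ∈ S, dist x y ≤ τ / 4)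
    (hT : IsQuickShiftClusterTree S g τ T) {x y : Rd d} (hxS : x ∈ S) (hyS : y ∈ S) :
    mergeHeight (⋃ l : ℝ, clusterTree f l) f x y ≤
      mergeHeight (⋃ l > (0 : ℝ), T l) φ x y + 5 * ε := by
  have hm := mergeHeight_nonneg (⋃ l > (0 : ℝ), T l) hφ x y
  refine mergeHeight_le hf (by positivity) ?_
  intro A hA hx hy v hv
  obtain ⟨l', x₀, -, rfl⟩ := Set.mem_iUnion.1 hA
  obtain ⟨G, hG, hlink⟩ := hT
  set A := connectedComponentIn (levelSet f l') x₀
  rcases le_or_gt v (5 * ε) with hle | hlt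
  · linarith
  have hl : 0 < v - 3 * ε := by linarith
  have hcover : ∀ s ∈ S, ∀ z ∈ A, dist s z ≤ τ / 4 → ∃ B ∈ T (v - 3 * ε), s ∈ B := by
    intro s hs z hz hsz
    suffices h : s ∈ ⋃₀ T (v - 3 * ε) from h
    rw [(hlink _ hl).sUnion_eq, sUnion_levelComponents]
    have h₁ := abs_le.1 (hosc s z (by linarith))
    have h₂ := abs_le.1 (hgf s hs)
    have h₃ := hv z hz
    exact ⟨hs, by linarith⟩
  have key : ∀ B ∈ T (v - 3 * ε), (∃ s ∈ B, dist s x ≤ τ / 4) →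
      ∀ t ∈ S, dist t y ≤ τ / 4 → t ∈ B := by
    refine IsPreconnected.induction₂' isPreconnected_connectedComponentIn
      (fun p q => ∀ B ∈ T (v - 3 * ε), (∃ s ∈ B, dist s p ≤ τ / 4) →
        ∀ t ∈ S, dist t q ≤ τ / 4 → t ∈ B) ?_ ?_ hx hy
    · have hclose : ∀ p q, q ∈ A → dist p q < τ / 2 → ∀ B ∈ T (v - 3 * ε),
          (∃ s ∈ B, dist s p ≤ τ / 4) → ∀ t ∈ S, dist t q ≤ τ / 4 → t ∈ B := by
        rintro p q hq hpq B hB ⟨s, hs, hsp⟩ t ht htq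
        obtain ⟨B', hB', htB'⟩ := hcover t ht q hq htq
        have hst : dist s t < τ := by
          have h₁ := dist_triangle4 s p q t
          rw [dist_comm q t] at h₁
          linarith
        rwa [(hlink _ hl).eq_of_dist_lt hB hB' hs htB' hst]
      intro p hp
      filter_upwards [self_mem_nhdsWithin,
        mem_nhdsWithin_of_mem_nhds (Metric.ball_mem_nhds p (half_pos hτ))] with q hq hpq
      exact ⟨hclose p q hq (by rwa [dist_comm]), hclose q p hp hpq⟩
    · rintro p q r - hq - hpq hqr B hB hs t ht htr
      -- a sample point near `q` links the two halves of the chain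
      obtain ⟨u, hu, huq⟩ := hcov q (by linarith [hv q hq])
      exact hqr B hB ⟨u, hpq B hB hs u hu huq, huq⟩ t ht htr
  have hself : ∀ z : Rd d, dist z z ≤ τ / 4 := fun z => by rw [dist_self]; positivity
  obtain ⟨B, hB, hxB⟩ := hcover x hxS x hx (hself x)
  suffices v - 5 * ε ≤ mergeHeight (⋃ l > (0 : ℝ), T l) φ x y by linarith
  refine le_mergeHeight hφ (Set.mem_iUnion₂.2 ⟨v - 3 * ε, hl, hB⟩) hxB
    (key B hB ⟨x, hxB, hself x⟩ y hyS (hself y)) fun z hz => ?_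
  have hz' : z ∈ ⋃₀ T (v - 3 * ε) := ⟨B, hB, hz⟩
  rw [(hlink _ hl).sUnion_eq, sUnion_levelComponents] at hz'
  have h₁ := abs_le.1 (hgf z hz'.1)
  have h₂ := abs_le.1 (hφf z hz'.1)
  linarith [hz'.2]

theorem mergeDistortion_le {d : ℕ} {S : Set (Rd d)} {f g φ : Rd d → ℝ} {τ ε : ℝ}
    {T : ℝ → Set (Set (Rd d))} (hε : 0 < ε) (hτ : 0 < τ) (hf : ∀ x, 0 ≤ f x)
    (hφ : ∀ x, 0 ≤ φ x) (hgf : ∀ x ∈ S, |g x - f x| ≤ ε) (hφf : ∀ x ∈ S, |φ x - f x| ≤ ε)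
    (hosc : ∀ x y, dist x y ≤ τ → |f x - f y| ≤ ε)
    (hcov : ∀ y, ε ≤ f y → ∃ x ∈ S, dist x y ≤ τ / 4)
    (hT : IsQuickShiftClusterTree S g τ T) :
    mergeDistortion S (⋃ l : ℝ, clusterTree f l) f (⋃ l > (0 : ℝ), T l) φ ≤ 5 * ε := by
  refine Real.sSup_le ?_ (by positivity)
  rintro _ ⟨x, hx, y, hy, rfl⟩
  have h₁ := mergeHeight_le_clusterTree hε.le hτ.le hf hφ hφf hosc hT x y
  have h₂ := clusterTree_mergeHeight_le hε hτ hf hφ hgf hφf hosc hcov hT hx hy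
  exact abs_le.2 ⟨by linarith, by linarith⟩

theorem mergeDistortion_nonneg {d : ℕ} (S : Set (Rd d)) (𝒞₁ 𝒞₂ : Set (Set (Rd d)))
    (g₁ g₂ : Rd d → ℝ) : 0 ≤ mergeDistortion S 𝒞₁ g₁ 𝒞₂ g₂ := by
  refine Real.sSup_nonneg ?_
  rintro _ ⟨x, -, y, -, rfl⟩
  exact abs_nonneg _

/-! ### Deviation inequalities -/

/-- A one-sided Bernstein inequality, from `exp u ≤ 1 + u + u ^ 2` for `|u| ≤ 1`. -/
theorem measureReal_sum_sub_ge_le {ι Ω : Type*} [MeasurableSpace Ω] {μ : Measure Ω}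
    [IsProbabilityMeasure μ] {Y : ι → Ω → ℝ} (hY : ∀ i, Measurable (Y i)) (hind : iIndepFun Y μ)
    {M V m t : ℝ} (hYM : ∀ i ω, |Y i ω| ≤ M) (hmean : ∀ i, ∫ ω, Y i ω ∂μ = m)
    (hV : ∀ i, ∫ ω, Y i ω ^ 2 ∂μ ≤ V) (ht : 0 ≤ t) (htM : t * M ≤ 1) (s : Finset ι) (a : ℝ) :
    μ.real {ω | a ≤ ∑ i ∈ s, (Y i ω - m)} ≤ Real.exp (-t * a + s.card * (t ^ 2 * V)) := by
  have hint : ∀ i, Integrable (Y i) μ := fun i =>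
    .of_bound (hY i).aestronglyMeasurable M (.of_forall fun ω => hYM i ω)
  have hint2 : ∀ i, Integrable (fun ω => Y i ω ^ 2) μ := fun i =>
    .of_bound ((hY i).pow_const 2).aestronglyMeasurable (M ^ 2) (.of_forall fun ω => by
      rw [Real.norm_eq_abs, abs_pow]; gcongr; exact hYM i ω)
  have hbound : ∀ i ω, Real.exp (t * (Y i ω - m)) ≤
      (1 + t * Y i ω + t ^ 2 * Y i ω ^ 2) * Real.exp (-(t * m)) := by
    intro i ω
    have h1 : ‖t * Y i ω‖ ≤ 1 := by
      rw [Real.norm_eq_abs, abs_mul, abs_of_nonneg ht]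
      exact (mul_le_mul_of_nonneg_left (hYM i ω) ht).trans htM
    have h2 := (abs_le.1 (Real.norm_exp_sub_one_sub_id_le h1)).2
    rw [Real.norm_eq_abs, sq_abs, mul_pow] at h2
    rw [mul_sub, sub_eq_add_neg, Real.exp_add]
    gcongr
    linarith
  have hint3 : ∀ i, Integrable
      (fun ω => (1 + t * Y i ω + t ^ 2 * Y i ω ^ 2) * Real.exp (-(t * m))) μ := fun i =>
    (((integrable_const _).add ((hint i).const_mul _)).add ((hint2 i).const_mul _)).mul_const _
  have hexp_int : ∀ i, Integrable (fun ω => Real.exp (t * (Y i ω - m))) μ := fun i =>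
    (hint3 i).mono' (by have := hY i; fun_prop)
      (.of_forall fun ω => by rw [Real.norm_eq_abs, Real.abs_exp]; exact hbound i ω)
  have hmgf : ∀ i, mgf (fun ω => Y i ω - m) μ t ≤ Real.exp (t ^ 2 * V) := by
    intro i
    calc mgf (fun ω => Y i ω - m) μ t
        ≤ ∫ ω, (1 + t * Y i ω + t ^ 2 * Y i ω ^ 2) * Real.exp (-(t * m)) ∂μ :=
          integral_mono (hexp_int i) (hint3 i) (hbound i)
      _ = (1 + t * m + t ^ 2 * ∫ ω, Y i ω ^ 2 ∂μ) * Real.exp (-(t * m)) := by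
          rw [integral_mul_const, integral_add, integral_add, integral_const_mul,
            integral_const_mul, hmean]
          · simp
          · exact integrable_const _
          · exact (hint i).const_mul _
          · exact (integrable_const _).add ((hint i).const_mul _)
          · exact (hint2 i).const_mul _
      _ ≤ Real.exp (t * m + t ^ 2 * V) * Real.exp (-(t * m)) := by
          gcongr
          have h1 := Real.add_one_le_exp (t * m + t ^ 2 * V)
          have h2 := mul_le_mul_of_nonneg_left (hV i) (sq_nonneg t)
          linarith
      _ = Real.exp (t ^ 2 * V) := by rw [← Real.exp_add]; congr 1; ring
  have hind' : iIndepFun (fun i ω => Y i ω - m) μ :=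
    hind.comp (fun _ y => y - m) fun _ => by fun_prop
  have hmeas' : ∀ i, Measurable fun ω => Y i ω - m := fun i => (hY i).sub_const m
  have hsum : (fun ω => ∑ i ∈ s, (Y i ω - m)) = ∑ i ∈ s, fun ω => Y i ω - m := by
    ext ω; simp
  have hcher := measure_ge_le_exp_mul_mgf (μ := μ) (X := fun ω => ∑ i ∈ s, (Y i ω - m)) a ht (by
    have := hind'.integrable_exp_mul_sum hmeas' (s := s) fun i _ => hexp_int i
    rwa [← hsum] at this)
  refine hcher.trans ?_
  rw [Real.exp_add, hsum, hind'.mgf_sum hmeas']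
  gcongr
  calc ∏ i ∈ s, mgf (fun ω => Y i ω - m) μ t
      ≤ ∏ _i ∈ s, Real.exp (t ^ 2 * V) :=
        Finset.prod_le_prod (fun i _ => mgf_nonneg) fun i _ => hmgf i
    _ = Real.exp (s.card * (t ^ 2 * V)) := by
        rw [Finset.prod_const, ← Real.exp_nat_mul]

theorem measureReal_abs_sum_sub_ge_le {ι Ω : Type*} [MeasurableSpace Ω] {μ : Measure Ω}
    [IsProbabilityMeasure μ] {Y : ι → Ω → ℝ} (hY : ∀ i, Measurable (Y i)) (hind : iIndepFun Y μ)
    {M V m t : ℝ} (hYM : ∀ i ω, |Y i ω| ≤ M) (hmean : ∀ i, ∫ ω, Y i ω ∂μ = m)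
    (hV : ∀ i, ∫ ω, Y i ω ^ 2 ∂μ ≤ V) (ht : 0 ≤ t) (htM : t * M ≤ 1) (s : Finset ι) (a : ℝ) :
    μ.real {ω | a ≤ |∑ i ∈ s, (Y i ω - m)|} ≤
      2 * Real.exp (-t * a + s.card * (t ^ 2 * V)) := by
  have h₁ := measureReal_sum_sub_ge_le hY hind hYM hmean hV ht htM s a
  have h₂ := measureReal_sum_sub_ge_le (Y := fun i ω => -Y i ω) (m := -m)
    (fun i => (hY i).neg) (hind.comp (fun _ y => -y) fun _ => measurable_neg)
    (fun i ω => by rw [abs_neg]; exact hYM i ω) (fun i => by rw [integral_neg, hmean])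
    (fun i => by simpa using hV i) ht htM s a
  have hsub : {ω | a ≤ |∑ i ∈ s, (Y i ω - m)|} ⊆
      {ω | a ≤ ∑ i ∈ s, (Y i ω - m)} ∪ {ω | a ≤ ∑ i ∈ s, (-Y i ω - -m)} := by
    intro ω hω
    have hneg : ∑ i ∈ s, (-Y i ω - -m) = -∑ i ∈ s, (Y i ω - m) := by
      rw [← Finset.sum_neg_distrib]
      exact Finset.sum_congr rfl fun i _ => by ring
    simp only [Set.mem_union, Set.mem_ofPred_eq, hneg]
    exact le_abs.1 hω
  calc _ ≤ _ := measureReal_mono hsub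
    _ ≤ _ := measureReal_union_le _ _
    _ ≤ _ := by linarith

/-- If `U` is independent of `V`, an event about `(U, V)` that has probability at most `p` for each
frozen value of `U` has probability at most `p`. -/
theorem ProbabilityTheory.IndepFun.measure_preimage_prod_le {Ω α β : Type*} [MeasurableSpace Ω]
    [MeasurableSpace α] [MeasurableSpace β] {μ : Measure Ω} [IsProbabilityMeasure μ]
    {U : Ω → α} {V : Ω → β} (hind : IndepFun U V μ) (hU : Measurable U) (hV : Measurable V)
    {B : Set (α × β)} (hB : MeasurableSet B) {p : ℝ≥0∞}
    (h : ∀ x, μ {ω | (x, V ω) ∈ B} ≤ p) : μ {ω | (U ω, V ω) ∈ B} ≤ p := by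
  have := Measure.isProbabilityMeasure_map (μ := μ) hU.aemeasurable
  have := Measure.isProbabilityMeasure_map (μ := μ) hV.aemeasurable
  calc μ {ω | (U ω, V ω) ∈ B} = μ.map (fun ω => (U ω, V ω)) B :=
        (Measure.map_apply (hU.prodMk hV) hB).symm
    _ = ∫⁻ x, μ.map V (Prod.mk x ⁻¹' B) ∂μ.map U := by
        rw [(indepFun_iff_map_prod_eq_prod_map_map hU.aemeasurable hV.aemeasurable).1 hind,
          Measure.prod_apply hB]
    _ ≤ ∫⁻ _, p ∂μ.map U := lintegral_mono fun x => by
        rw [Measure.map_apply hV (measurable_prodMk_left hB)]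
        exact h x
    _ = p := by simp

/-! ### The kernel density estimator at the sample points -/

/-- A kernel is integrable, because the integral of a non-integrable function is `0` by
convention. -/
theorem IsRadialKernel.integrable {d : ℕ} {K : Rd d → ℝ} (hK : IsRadialKernel K) :
    Integrable K := by
  by_contra h
  have := hK.integral_eq_one
  rw [integral_undef h] at this
  exact zero_ne_one this

theorem IsRadialKernel.nonneg {d : ℕ} {K : Rd d → ℝ} (hK : IsRadialKernel K) (u : Rd d) :
    0 ≤ K u := by
  obtain ⟨k, -, hk, -⟩ := hK.exists_profile
  rw [hk]
  exact (k _).2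

theorem IsRadialKernel.measurable {d : ℕ} {K : Rd d → ℝ} (hK : IsRadialKernel K) :
    Measurable K := by
  obtain ⟨k, hanti, hk, -⟩ := hK.exists_profile
  rw [funext hk]
  exact measurable_coe_nnreal_real.comp (hanti.measurable.comp measurable_nnnorm)

theorem IsRadialKernel.exists_bound {d : ℕ} {K : Rd d → ℝ} (hK : IsRadialKernel K) :
    ∃ M : ℝ, 0 < M ∧ ∀ u, K u ≤ M := by
  obtain ⟨k, hanti, hk, -⟩ := hK.exists_profile
  refine ⟨k 0 + 1, by positivity, fun u => ?_⟩
  have h : (k ‖u‖₊ : ℝ) ≤ k 0 := NNReal.coe_le_coe.2 (hanti zero_le)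
  rw [hk]
  linarith

theorem kde_nonneg {d : ℕ} {K : Rd d → ℝ} (hK : ∀ u, 0 ≤ K u) {h : ℝ} (hh : 0 < h) (n : ℕ)
    (x : Fin n → Rd d) (y : Rd d) : 0 ≤ kde K h n x y :=
  mul_nonneg (by positivity) (Finset.sum_nonneg fun _ _ => hK _)

/-- The bias of the kernel density estimator of a bounded uniformly continuous function vanishes
uniformly as the bandwidth tends to `0`. -/
theorem exists_abs_integral_kernel_sub_le {d : ℕ} {K f : Rd d → ℝ} (hK : Integrable K)
    (hK0 : ∀ u, 0 ≤ K u) (hK1 : ∫ u, K u = 1) (hf : UniformContinuous f) {F : ℝ}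
    (hfF : ∀ x, |f x| ≤ F) {ε : ℝ} (hε : 0 < ε) :
    ∃ h₀ : ℝ, 0 < h₀ ∧ ∀ h : ℝ, 0 < h → h < h₀ → ∀ x, |(∫ u, K u * f (x - h • u)) - f x| ≤ ε := by
  have hF : 0 ≤ F := (abs_nonneg _).trans (hfF 0)
  have htail : Tendsto (fun n : ℕ => ∫ u in {u : Rd d | (n : ℝ) ≤ ‖u‖}, K u) atTop (𝓝 0) := by
    have h := tendsto_setIntegral_of_antitone (f := K) (μ := volume)
      (s := fun n : ℕ => {u : Rd d | (n : ℝ) ≤ ‖u‖})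
      (fun n => measurableSet_le measurable_const measurable_norm)
      (fun m n hmn u (hu : (n : ℝ) ≤ ‖u‖) => (Nat.cast_le.2 hmn).trans hu)
      ⟨0, hK.integrableOn⟩
    have hempty : ⋂ n : ℕ, {u : Rd d | (n : ℝ) ≤ ‖u‖} = ∅ := by
      refine Set.eq_empty_of_forall_notMem fun u hu => ?_
      obtain ⟨n, hn⟩ := exists_nat_gt ‖u‖
      exact absurd (Set.mem_iInter.1 hu n) (not_le.2 hn)
    rwa [hempty, setIntegral_empty] at h
  obtain ⟨N, hN⟩ := (htail.eventually_lt_const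
    (show (0 : ℝ) < ε / 2 / (2 * F + 1) by positivity)).exists
  obtain ⟨δ, hδ, hfδ⟩ := Metric.uniformContinuous_iff.1 hf (ε / 2) (by positivity)
  set R : Set (Rd d) := {u | (N : ℝ) ≤ ‖u‖}
  have hR : MeasurableSet R := measurableSet_le measurable_const measurable_norm
  refine ⟨δ / (N + 1), by positivity, fun h hh hhδ x => ?_⟩
  have hfc : Continuous f := hf.continuous
  have hKf : Integrable fun u => K u * f (x - h • u) :=
    hK.mul_bdd (c := F) (by fun_prop) (.of_forall fun u => hfF _)
  have hdiff : (∫ u, K u * f (x - h • u)) - f x = ∫ u, K u * (f (x - h • u) - f x) := by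
    simp_rw [mul_sub]
    rw [integral_sub hKf (hK.mul_const _), integral_mul_const, hK1, one_mul]
  have hdom : Integrable fun u => K u * (ε / 2) + R.indicator K u * (2 * F) :=
    (hK.mul_const _).add ((hK.indicator hR).mul_const _)
  rw [hdiff, ← Real.norm_eq_abs]
  calc ‖∫ u, K u * (f (x - h • u) - f x)‖
      ≤ ∫ u, K u * (ε / 2) + R.indicator K u * (2 * F) := by
        refine norm_integral_le_of_norm_le hdom (.of_forall fun u => ?_)
        rw [Real.norm_eq_abs, abs_mul, abs_of_nonneg (hK0 u)]
        by_cases hu : u ∈ R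
        · rw [Set.indicator_of_mem hu, ← mul_add]
          refine mul_le_mul_of_nonneg_left ?_ (hK0 u)
          have h₁ := abs_sub (f (x - h • u)) (f x)
          linarith [hfF x, hfF (x - h • u)]
        · rw [Set.indicator_of_notMem hu, zero_mul, add_zero]
          refine mul_le_mul_of_nonneg_left ?_ (hK0 u)
          have hu' : ‖u‖ < N := not_le.1 hu
          have hd : dist (x - h • u) x < δ := by
            rw [dist_eq_norm, sub_sub_cancel_left, norm_neg, norm_smul, Real.norm_eq_abs,
              abs_of_pos hh]
            calc h * ‖u‖ ≤ h * (N + 1) := by gcongr; linarith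
              _ < δ := (lt_div_iff₀ (by positivity)).1 hhδ
          exact (hfδ hd).le
    _ = ε / 2 + (∫ u in R, K u) * (2 * F) := by
        rw [integral_add (hK.mul_const _) ((hK.indicator hR).mul_const _), integral_mul_const,
          integral_mul_const, integral_indicator hR, hK1, one_mul]
    _ ≤ ε / 2 + ε / 2 / (2 * F + 1) * (2 * F + 1) := by
        gcongr
        linarith
    _ = ε := by field_simp; ring

theorem integral_kernel_comp_sub {d : ℕ} (K f : Rd d → ℝ) {h : ℝ} (hh : 0 < h) (x : Rd d) :
    ∫ y, K (h⁻¹ • (x - y)) * f y = h ^ d * ∫ u, K u * f (x - h • u) := by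
  have h₁ := integral_sub_left_eq_self (fun z => K (h⁻¹ • z) * f (x - z)) volume x
  have h₂ := Measure.integral_comp_smul volume (fun u => K u * f (x - h • u)) h⁻¹
  simp only [smul_inv_smul₀ hh.ne', sub_sub_cancel] at h₁ h₂
  rw [h₁, h₂, finrank_euclideanSpace_fin, inv_pow, inv_inv, abs_of_pos (by positivity),
    smul_eq_mul]

theorem integral_comp_eq_of_map_eq_withDensity {Ω E : Type*} [MeasurableSpace Ω]
    [MeasurableSpace E] {μ : Measure Ω} {ν : Measure E} {X : Ω → E} (hX : Measurable X)
    {f : E → ℝ} (hf : Measurable f) (hf0 : ∀ x, 0 ≤ f x)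
    (hlaw : μ.map X = ν.withDensity fun x => ENNReal.ofReal (f x)) {φ : E → ℝ}
    (hφ : Measurable φ) : ∫ ω, φ (X ω) ∂μ = ∫ y, φ y * f y ∂ν := by
  rw [← integral_map hX.aemeasurable hφ.aestronglyMeasurable, hlaw,
    integral_withDensity_eq_integral_toReal_smul (by fun_prop) (.of_forall fun _ => by simp)]
  refine integral_congr_ae (.of_forall fun y => ?_)
  simp only [ENNReal.toReal_ofReal (hf0 y), smul_eq_mul, mul_comm]
/-- Bernstein's inequality for the kernel sum at a fixed point `x`. The summands have second moment
at most `M F h ^ d`, since their mean is at most `F h ^ d`. They are centred at `h ^ d * f x`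
instead of their mean, at the cost of the bias, so that the event is measurable in `x`. -/
theorem measureReal_abs_sum_kernel_sub_ge_le {d : ℕ} {f K : Rd d → ℝ} {F M h ε t : ℝ}
    (hf : Measurable f) (hf0 : ∀ x, 0 ≤ f x) (hfF : ∀ x, f x ≤ F) (hK : Measurable K)
    (hKi : Integrable K) (hK1 : ∫ u, K u = 1) (hK0 : ∀ u, 0 ≤ K u) (hKM : ∀ u, K u ≤ M)
    (hh : 0 < h) (hbias : ∀ x, |(∫ u, K u * f (x - h • u)) - f x| ≤ ε)
    (ht : 0 ≤ t) (htM : t * M ≤ 1) (htF : t * (M * F) ≤ ε / 2)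
    {Ω : Type*} [MeasurableSpace Ω] {μ : Measure Ω} [IsProbabilityMeasure μ] {n : ℕ}
    {X : Fin n → Ω → Rd d} (hX : ∀ i, Measurable (X i)) (hind : iIndepFun X μ)
    (hlaw : ∀ i, μ.map (X i) = volume.withDensity fun x => ENNReal.ofReal (f x))
    (s : Finset (Fin n)) (x : Rd d) :
    μ.real {ω | 2 * ε * (n * h ^ d) ≤ |∑ i ∈ s, (K (h⁻¹ • (x - X i ω)) - h ^ d * f x)|} ≤
      2 * Real.exp (-(t * ε / 2 * (n * h ^ d))) := by
  have hM0 : 0 ≤ M := (hK0 0).trans (hKM 0)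
  have hF0 : 0 ≤ F := (hf0 0).trans (hfF 0)
  set m := h ^ d * ∫ u, K u * f (x - h • u) with hm
  have hφ : Measurable fun y => K (h⁻¹ • (x - y)) := by fun_prop
  have hmean : ∀ i, ∫ ω, K (h⁻¹ • (x - X i ω)) ∂μ = m := fun i => by
    rw [integral_comp_eq_of_map_eq_withDensity (hX i) hf hf0 (hlaw i) hφ,
      integral_kernel_comp_sub K f hh]
  have hmF : m ≤ h ^ d * F := by
    refine mul_le_mul_of_nonneg_left ?_ (by positivity)
    calc ∫ u, K u * f (x - h • u) ≤ ∫ u, K u * F :=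
          integral_mono_of_nonneg (.of_forall fun u => mul_nonneg (hK0 u) (hf0 _))
            (hKi.mul_const F) (.of_forall fun u => mul_le_mul_of_nonneg_left (hfF _) (hK0 u))
      _ = F := by rw [integral_mul_const, hK1, one_mul]
  have hV : ∀ i, ∫ ω, K (h⁻¹ • (x - X i ω)) ^ 2 ∂μ ≤ M * (h ^ d * F) := fun i => by
    have hint : Integrable (fun ω => K (h⁻¹ • (x - X i ω))) μ :=
      .of_bound (hφ.comp (hX i)).aestronglyMeasurable M (.of_forall fun ω => by
        rw [Real.norm_eq_abs, abs_of_nonneg (hK0 _)]; exact hKM _)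
    calc ∫ ω, K (h⁻¹ • (x - X i ω)) ^ 2 ∂μ ≤ ∫ ω, M * K (h⁻¹ • (x - X i ω)) ∂μ :=
          integral_mono_of_nonneg (.of_forall fun ω => sq_nonneg _) (hint.const_mul M)
            (.of_forall fun ω => by
              simp only [sq]
              exact mul_le_mul_of_nonneg_right (hKM _) (hK0 _))
      _ ≤ M * (h ^ d * F) := by
          rw [integral_const_mul, hmean]
          exact mul_le_mul_of_nonneg_left hmF hM0
  have hbern := measureReal_abs_sum_sub_ge_le (Y := fun i ω => K (h⁻¹ • (x - X i ω)))
    (fun i => hφ.comp (hX i)) (hind.comp (fun _ y => K (h⁻¹ • (x - y))) fun _ => hφ)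
    (fun i ω => by rw [abs_of_nonneg (hK0 _)]; exact hKM _) hmean hV ht htM s (ε * (n * h ^ d))
  have hcard : (s.card : ℝ) ≤ n := by
    exact_mod_cast (s.card_le_univ.trans_eq (Fintype.card_fin n))
  have hmf : |m - h ^ d * f x| ≤ h ^ d * ε := by
    rw [hm, ← mul_sub, abs_mul, abs_of_pos (by positivity : 0 < h ^ d)]
    exact mul_le_mul_of_nonneg_left (hbias x) (by positivity)
  have hε : 0 ≤ ε := (abs_nonneg _).trans (hbias x)
  have hsub : {ω | 2 * ε * (n * h ^ d) ≤ |∑ i ∈ s, (K (h⁻¹ • (x - X i ω)) - h ^ d * f x)|} ⊆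
      {ω | ε * (n * h ^ d) ≤ |∑ i ∈ s, (K (h⁻¹ • (x - X i ω)) - m)|} := by
    intro ω hω
    rw [Set.mem_ofPred_eq] at hω ⊢
    have hsum : ∑ i ∈ s, (K (h⁻¹ • (x - X i ω)) - h ^ d * f x) =
        ∑ i ∈ s, (K (h⁻¹ • (x - X i ω)) - m) + s.card * (m - h ^ d * f x) := by
      rw [← nsmul_eq_mul, ← Finset.sum_const, ← Finset.sum_add_distrib]
      exact Finset.sum_congr rfl fun i _ => by ring
    have h₁ : |s.card * (m - h ^ d * f x)| ≤ n * (h ^ d * ε) := by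
      rw [abs_mul, Nat.abs_cast]
      gcongr
    have h₂ := abs_add_le (∑ i ∈ s, (K (h⁻¹ • (x - X i ω)) - m)) (s.card * (m - h ^ d * f x))
    rw [← hsum] at h₂
    linarith
  refine (measureReal_mono hsub).trans (hbern.trans ?_)
  gcongr
  have h₁ : (s.card : ℝ) * (t ^ 2 * (M * (h ^ d * F))) ≤ n * (t ^ 2 * (M * (h ^ d * F))) := by
    gcongr
  have h₂ : t * (n * h ^ d) * (t * (M * F)) ≤ t * (n * h ^ d) * (ε / 2) := by gcongr
  linarith

/-- The union bound over the sample points. The point at which the estimator is evaluated is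
independent of the other sample points; its own contribution is at most `M`. -/
theorem measure_exists_abs_kde_sub_gt_le {d : ℕ} {f K : Rd d → ℝ} {F M h ε t : ℝ}
    (hf : Measurable f) (hf0 : ∀ x, 0 ≤ f x) (hfF : ∀ x, f x ≤ F) (hK : Measurable K)
    (hKi : Integrable K) (hK1 : ∫ u, K u = 1) (hK0 : ∀ u, 0 ≤ K u) (hKM : ∀ u, K u ≤ M)
    (hh : 0 < h) (hbias : ∀ x, |(∫ u, K u * f (x - h • u)) - f x| ≤ ε)
    (ht : 0 ≤ t) (htM : t * M ≤ 1) (htF : t * (M * F) ≤ ε / 2)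
    {Ω : Type*} [MeasurableSpace Ω] {μ : Measure Ω} [IsProbabilityMeasure μ] {n : ℕ}
    {X : Fin n → Ω → Rd d} (hX : ∀ i, Measurable (X i)) (hind : iIndepFun X μ)
    (hlaw : ∀ i, μ.map (X i) = volume.withDensity fun x => ENNReal.ofReal (f x))
    (hn : M + h ^ d * F ≤ ε * (n * h ^ d)) :
    μ {ω | ∃ j, 3 * ε < |kde K h n (fun i => X i ω) (X j ω) - f (X j ω)|} ≤
      ENNReal.ofReal (n * (2 * Real.exp (-(t * ε / 2 * (n * h ^ d))))) := by
  classical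
  have hpoint : ∀ j, μ {ω | 2 * ε * (n * h ^ d) ≤
      |∑ i ∈ Finset.univ.erase j, (K (h⁻¹ • (X j ω - X i ω)) - h ^ d * f (X j ω))|} ≤
      ENNReal.ofReal (2 * Real.exp (-(t * ε / 2 * (n * h ^ d)))) := by
    intro j
    have hUV : IndepFun (X j) (fun ω (i : ↥(Finset.univ.erase j)) => X i ω) μ :=
      (hind.indepFun_finset {j} (Finset.univ.erase j) (by simp) hX).comp
        (φ := fun p : ↥({j} : Finset (Fin n)) → Rd d => p ⟨j, Finset.mem_singleton_self j⟩)
        (ψ := id) (measurable_pi_apply _) measurable_id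
    let B : Set (Rd d × (↥(Finset.univ.erase j) → Rd d)) :=
      {p | 2 * ε * (n * h ^ d) ≤
        |∑ i, (K (h⁻¹ • (p.1 - p.2 i)) - h ^ d * f p.1)|}
    have hB : MeasurableSet B := by
      refine measurableSet_le measurable_const ?_
      fun_prop
    have hsum : ∀ (x : Rd d) (ω : Ω),
        ∑ i : ↥(Finset.univ.erase j), (K (h⁻¹ • (x - X i ω)) - h ^ d * f x) =
          ∑ i ∈ Finset.univ.erase j, (K (h⁻¹ • (x - X i ω)) - h ^ d * f x) := fun x ω =>
      Finset.sum_coe_sort (Finset.univ.erase j)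
        fun i => K (h⁻¹ • (x - X i ω)) - h ^ d * f x
    have hmain := hUV.measure_preimage_prod_le (hX j)
      (measurable_pi_lambda _ fun i => hX i) hB
      (p := ENNReal.ofReal (2 * Real.exp (-(t * ε / 2 * (n * h ^ d))))) (fun x => by
        have := measureReal_abs_sum_kernel_sub_ge_le hf hf0 hfF hK hKi hK1 hK0 hKM hh hbias ht
          htM htF hX hind hlaw (Finset.univ.erase j) x
        rw [measureReal_def] at this
        rw [← ENNReal.ofReal_toReal (measure_ne_top μ _)]
        refine ENNReal.ofReal_le_ofReal (le_trans (le_of_eq ?_) this)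
        congr 2
        ext ω
        simp only [B, Set.mem_ofPred_eq, hsum])
    refine le_trans (le_of_eq ?_) hmain
    congr 1
    ext ω
    simp only [B, Set.mem_ofPred_eq, hsum]
  have hsub : {ω | ∃ j, 3 * ε < |kde K h n (fun i => X i ω) (X j ω) - f (X j ω)|} ⊆
      ⋃ j ∈ (Finset.univ : Finset (Fin n)), {ω | 2 * ε * (n * h ^ d) ≤
        |∑ i ∈ Finset.univ.erase j, (K (h⁻¹ • (X j ω - X i ω)) - h ^ d * f (X j ω))|} := by
    rintro ω ⟨j, hj⟩
    refine Set.mem_biUnion (Finset.mem_univ j) ?_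
    have hn0 : (0 : ℝ) < n := Nat.cast_pos.2 (Fin.pos j)
    have hnh : 0 < n * h ^ d := by positivity
    set y := X j ω
    have hkde : kde K h n (fun i => X i ω) y - f y =
        (∑ i, (K (h⁻¹ • (y - X i ω)) - h ^ d * f y)) / (n * h ^ d) := by
      rw [kde, Finset.sum_sub_distrib, Finset.sum_const, Finset.card_univ, Fintype.card_fin,
        nsmul_eq_mul]
      field_simp
    rw [hkde, abs_div, abs_of_pos hnh, lt_div_iff₀ hnh,
      ← Finset.add_sum_erase _ _ (Finset.mem_univ j)] at hj
    have h₁ := abs_add_le (K (h⁻¹ • (y - X j ω)) - h ^ d * f y)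
      (∑ i ∈ Finset.univ.erase j, (K (h⁻¹ • (y - X i ω)) - h ^ d * f y))
    have h₂ : |K (h⁻¹ • (y - X j ω)) - h ^ d * f y| ≤ M + h ^ d * F := by
      have h₃ : 0 ≤ h ^ d * f y := mul_nonneg (by positivity) (hf0 y)
      have h₄ : h ^ d * f y ≤ h ^ d * F := mul_le_mul_of_nonneg_left (hfF y) (by positivity)
      have h₅ := hK0 (h⁻¹ • (y - X j ω))
      have h₆ := hKM (h⁻¹ • (y - X j ω))
      exact abs_le.2 ⟨by linarith, by linarith⟩
    rw [Set.mem_ofPred_eq]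
    linarith
  calc _ ≤ _ := measure_mono hsub
    _ ≤ ∑ j : Fin n, _ := measure_biUnion_finset_le _ _
    _ ≤ ∑ _j : Fin n, ENNReal.ofReal (2 * Real.exp (-(t * ε / 2 * (n * h ^ d)))) :=
        Finset.sum_le_sum fun j _ => hpoint j
    _ = _ := by
        rw [Finset.sum_const, Finset.card_univ, Fintype.card_fin, nsmul_eq_mul,
          ENNReal.ofReal_mul (Nat.cast_nonneg n), ENNReal.ofReal_natCast]

/-- At the sample points the kernel density estimator is uniformly consistent. -/
theorem tendsto_measure_exists_abs_kde_sub_gt {d : ℕ} {f K : Rd d → ℝ} {h : ℕ → ℝ}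
    (hf : Continuous f) (hf0 : ∀ x, 0 ≤ f x) (hf_supp : HasCompactSupport f)
    (hK : IsRadialKernel K) (hh_pos : ∀ n, 0 < h n) (hh : Tendsto h atTop (𝓝 0))
    (hnh : Tendsto (fun n : ℕ => Real.log n / (n * h n ^ d)) atTop (𝓝 0))
    {Ω : Type*} [MeasurableSpace Ω] {μ : Measure Ω} [IsProbabilityMeasure μ]
    {X : ℕ → Ω → Rd d} (hX : ∀ i, Measurable (X i)) (hind : iIndepFun X μ)
    (hlaw : ∀ i, μ.map (X i) = volume.withDensity fun x => ENNReal.ofReal (f x))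
    {ε : ℝ} (hε : 0 < ε) :
    Tendsto (fun n => μ {ω | ∃ j : Fin n,
      ε < |kde K (h n) n (sample X n ω) (X j ω) - f (X j ω)|}) atTop (𝓝 0) := by
  obtain ⟨M, hM0, hKM⟩ := hK.exists_bound
  obtain ⟨F, hF⟩ := hf_supp.exists_bound_of_continuous hf
  have hF0 : 0 ≤ F := (norm_nonneg _).trans (hF 0)
  obtain ⟨h₀, hh₀, hbias⟩ := exists_abs_integral_kernel_sub_le hK.integrable hK.nonneg
    hK.integral_eq_one (hf_supp.uniformContinuous_of_continuous hf) hF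
    (show 0 < ε / 3 by positivity)
  -- `t` is small enough for both the exponential bound and the variance term
  obtain ⟨t, ht, htM, htF⟩ : ∃ t : ℝ, 0 < t ∧ t * M ≤ 1 ∧ t * (M * F) ≤ ε / 3 / 2 := by
    have h₁ : ∀ᶠ t in 𝓝[>] (0 : ℝ), t * M < 1 := by
      have : Tendsto (fun t : ℝ => t * M) (𝓝[>] 0) (𝓝 (0 * M)) :=
        (tendsto_id.mul_const M).mono_left nhdsWithin_le_nhds
      exact this.eventually_lt_const (by simp)
    have h₂ : ∀ᶠ t in 𝓝[>] (0 : ℝ), t * (M * F) < ε / 3 / 2 := by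
      have : Tendsto (fun t : ℝ => t * (M * F)) (𝓝[>] 0) (𝓝 (0 * (M * F))) :=
        (tendsto_id.mul_const _).mono_left nhdsWithin_le_nhds
      exact this.eventually_lt_const (by rw [zero_mul]; positivity)
    obtain ⟨t, h₁, h₂, h₃⟩ := (h₁.and (h₂.and self_mem_nhdsWithin)).exists
    exact ⟨t, h₃, h₁.le, h₂.le⟩
  set c := t * (ε / 3) / 2 with hc
  have hc0 : 0 < c := by positivity
  have hlog : Tendsto (fun n : ℕ => Real.log n) atTop atTop :=
    Real.tendsto_log_atTop.comp tendsto_natCast_atTop_atTop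
  -- `n h ^ d` eventually dominates any multiple of `log n`
  have hbig : ∀ b : ℝ, 0 < b → ∀ᶠ n : ℕ in atTop, b * Real.log n ≤ n * h n ^ d := by
    intro b hb
    filter_upwards [hnh.eventually_lt_const (inv_pos.2 hb), eventually_gt_atTop 0] with n hn hn0
    have hpos : 0 < n * h n ^ d := mul_pos (Nat.cast_pos.2 hn0) (pow_pos (hh_pos n) d)
    rw [div_lt_iff₀ hpos, lt_inv_mul_iff₀ hb] at hn
    exact hn.le
  have hlim : Tendsto (fun n : ℕ => ENNReal.ofReal (2 * (n : ℝ)⁻¹)) atTop (𝓝 0) := by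
    have := (tendsto_inv_atTop_nhds_zero_nat (𝕜 := ℝ)).const_mul 2
    rw [mul_zero] at this
    simpa using ENNReal.tendsto_ofReal this
  refine tendsto_of_tendsto_of_tendsto_of_le_of_le' tendsto_const_nhds hlim
    (.of_forall fun _ => zero_le) ?_
  filter_upwards [hh.eventually_lt_const hh₀, hbig (2 / c) (by positivity),
    hbig (2 * M / (ε / 3)) (by positivity), hlog.eventually_ge_atTop 1,
    tendsto_natCast_atTop_atTop.eventually_ge_atTop (2 * F / (ε / 3)),
    eventually_gt_atTop 0] with n hn₁ hn₂ hn₃ hn₄ hn₅ hn₀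
  have hnR : (0 : ℝ) < n := Nat.cast_pos.2 hn₀
  have hhd : 0 < h n ^ d := pow_pos (hh_pos n) d
  have hself : M + h n ^ d * F ≤ ε / 3 * (n * h n ^ d) := by
    have h₁ : 2 * M / (ε / 3) ≤ n * h n ^ d :=
      le_trans (le_mul_of_one_le_right (by positivity) hn₄) hn₃
    rw [div_le_iff₀ (by positivity)] at h₁ hn₅
    have h₂ := mul_le_mul_of_nonneg_left hn₅ hhd.le
    linarith
  have hmain := measure_exists_abs_kde_sub_gt_le (ε := ε / 3) hf.measurable hf0
    (fun x => (le_abs_self _).trans (hF x)) hK.measurable hK.integrable hK.integral_eq_one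
    hK.nonneg hKM (hh_pos n) (hbias _ (hh_pos n) hn₁) ht.le htM htF (n := n)
    (X := fun i ω => X i ω) (fun i => hX i) (hind.precomp Fin.val_injective) (fun i => hlaw i)
    hself
  rw [mul_div_cancel₀ ε three_ne_zero] at hmain
  refine hmain.trans (ENNReal.ofReal_le_ofReal ?_)
  rw [← hc]
  have hexp : Real.exp (-(c * (n * h n ^ d))) ≤ (n : ℝ)⁻¹ * (n : ℝ)⁻¹ := by
    rw [div_mul_eq_mul_div, div_le_iff₀ hc0] at hn₂
    rw [← Real.exp_log (inv_pos.2 hnR), ← Real.exp_add, Real.log_inv, Real.exp_le_exp]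
    linarith
  calc (n : ℝ) * (2 * Real.exp (-(c * (n * h n ^ d))))
      ≤ n * (2 * ((n : ℝ)⁻¹ * (n : ℝ)⁻¹)) := by gcongr
    _ = 2 * (n : ℝ)⁻¹ := by field_simp
/-! ### Sample points near every point of positive density -/

/-- A set whose separated finite subsets have bounded size has a finite separated net: a separated
subset of maximal size. -/
theorem exists_finset_separated_net {E : Type*} [PseudoMetricSpace E] {A : Set E} {r : ℝ}
    {k : ℕ} (hr : 0 < r)
    (hk : ∀ N : Finset E, (∀ z ∈ N, z ∈ A) → (N : Set E).Pairwise (fun x y => r ≤ dist x y) →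
      N.card ≤ k) :
    ∃ N : Finset E, (∀ z ∈ N, z ∈ A) ∧ (N : Set E).Pairwise (fun x y => r ≤ dist x y) ∧
      ∀ y ∈ A, ∃ z ∈ N, dist y z < r := by
  classical
  let s : Set ℕ := {m | ∃ N : Finset E, (∀ z ∈ N, z ∈ A) ∧
    (N : Set E).Pairwise (fun x y => r ≤ dist x y) ∧ N.card = m}
  have hs : BddAbove s := ⟨k, by rintro _ ⟨N, h₁, h₂, rfl⟩; exact hk N h₁ h₂⟩
  have hne : s.Nonempty := ⟨0, ∅, by simp, by simp, rfl⟩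
  obtain ⟨N, hNA, hNs, hN⟩ := Nat.sSup_mem hne hs
  refine ⟨N, hNA, hNs, fun y hy => ?_⟩
  by_contra! hfar
  have hyN : y ∉ N := fun h => by
    have := hfar y h
    rw [dist_self] at this
    linarith
  have hmem : (insert y N).card ∈ s := by
    refine ⟨insert y N, ?_, ?_, rfl⟩
    · intro z hz
      rcases Finset.mem_insert.1 hz with rfl | hz
      exacts [hy, hNA z hz]
    · rw [Finset.coe_insert]
      refine hNs.insert fun z hz _ => ⟨hfar z hz, ?_⟩
      rw [dist_comm]
      exact hfar z hz
  have := le_csSup hs hmem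
  rw [Finset.card_insert_of_notMem hyN, ← hN] at this
  omega

/-- If the balls of radius `ρ` about the points of `A` have mass at least `q`, then a `2ρ`-separated
net of `A` has at most `1 / q` points, and each ball about a point of the net is missed by all of
`n` independent points with probability at most `exp (-n q)`. -/
theorem measure_exists_forall_dist_ge_le {E : Type*} [PseudoMetricSpace E] [MeasurableSpace E]
    [OpensMeasurableSpace E] {P : Measure E} [IsProbabilityMeasure P] {A : Set E} {ρ q : ℝ}
    (hρ : 0 < ρ) (hq : 0 < q) (hA : ∀ z ∈ A, q ≤ P.real (Metric.ball z ρ))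
    {Ω : Type*} [MeasurableSpace Ω] {μ : Measure Ω} [IsProbabilityMeasure μ] {n : ℕ}
    {X : Fin n → Ω → E} (hX : ∀ i, Measurable (X i)) (hind : iIndepFun X μ)
    (hlaw : ∀ i, μ.map (X i) = P) :
    μ {ω | ∃ y ∈ A, ∀ i, 3 * ρ ≤ dist (X i ω) y} ≤
      ENNReal.ofReal (q⁻¹ * Real.exp (-(n * q))) := by
  have hcard : ∀ N : Finset E, (∀ z ∈ N, z ∈ A) →
      (N : Set E).Pairwise (fun x y => 2 * ρ ≤ dist x y) → (N.card : ℝ) ≤ q⁻¹ := by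
    intro N hNA hNs
    have hdisj : (N : Set E).PairwiseDisjoint fun z => Metric.ball z ρ := fun x hx y hy hxy =>
      Metric.ball_disjoint_ball (by linarith [hNs hx hy hxy])
    have hsum : ∑ z ∈ N, P.real (Metric.ball z ρ) ≤ 1 := by
      rw [← measureReal_biUnion_finset hdisj fun _ _ => Metric.isOpen_ball.measurableSet]
      exact measureReal_le_one
    have hle : N.card • q ≤ 1 :=
      (Finset.card_nsmul_le_sum N _ q fun z hz => hA z (hNA z hz)).trans hsum
    rw [nsmul_eq_mul] at hle
    rwa [← one_div, le_div_iff₀ hq]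
  obtain ⟨N, hNA, hNs, hN⟩ := exists_finset_separated_net (A := A) (k := ⌊q⁻¹⌋₊)
    (by positivity : 0 < 2 * ρ) fun N h₁ h₂ => Nat.le_floor (hcard N h₁ h₂)
  have hmiss : ∀ z ∈ N, μ (⋂ i ∈ (Finset.univ : Finset (Fin n)), X i ⁻¹' (Metric.ball z ρ)ᶜ) ≤
      ENNReal.ofReal (Real.exp (-(n * q))) := by
    intro z hz
    have hball : MeasurableSet (Metric.ball z ρ) := Metric.isOpen_ball.measurableSet
    rw [hind.measure_inter_preimage_eq_mul Finset.univ fun _ _ => hball.compl]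
    have hfac : ∀ i, μ (X i ⁻¹' (Metric.ball z ρ)ᶜ) ≤ ENNReal.ofReal (Real.exp (-q)) := by
      intro i
      rw [← Measure.map_apply (hX i) hball.compl, hlaw i, ← ofReal_measureReal,
        probReal_compl_eq_one_sub hball]
      refine ENNReal.ofReal_le_ofReal ?_
      linarith [hA z (hNA z hz), Real.one_sub_le_exp_neg q]
    calc ∏ i : Fin n, μ (X i ⁻¹' (Metric.ball z ρ)ᶜ)
        ≤ ∏ _i : Fin n, ENNReal.ofReal (Real.exp (-q)) := Finset.prod_le_prod' fun i _ => hfac i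
      _ = ENNReal.ofReal (Real.exp (-(n * q))) := by
          rw [Finset.prod_const, Finset.card_univ, Fintype.card_fin,
            ← ENNReal.ofReal_pow (Real.exp_pos _).le, ← Real.exp_nat_mul, mul_neg]
  have hsub : {ω | ∃ y ∈ A, ∀ i, 3 * ρ ≤ dist (X i ω) y} ⊆
      ⋃ z ∈ N, ⋂ i ∈ (Finset.univ : Finset (Fin n)), X i ⁻¹' (Metric.ball z ρ)ᶜ := by
    rintro ω ⟨y, hy, hfar⟩
    obtain ⟨z, hz, hyz⟩ := hN y hy
    refine Set.mem_biUnion hz (Set.mem_iInter₂.2 fun i _ => ?_)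
    rw [Set.mem_preimage, Set.mem_compl_iff, Metric.mem_ball, not_lt]
    have h₁ := dist_triangle (X i ω) z y
    rw [dist_comm z y] at h₁
    linarith [hfar i]
  calc _ ≤ _ := measure_mono hsub
    _ ≤ ∑ z ∈ N, _ := measure_biUnion_finset_le _ _
    _ ≤ ∑ _z ∈ N, ENNReal.ofReal (Real.exp (-(n * q))) := Finset.sum_le_sum hmiss
    _ = ENNReal.ofReal (N.card * Real.exp (-(n * q))) := by
        rw [Finset.sum_const, nsmul_eq_mul, ENNReal.ofReal_mul (Nat.cast_nonneg _),
          ENNReal.ofReal_natCast]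
    _ ≤ _ := ENNReal.ofReal_le_ofReal
        (mul_le_mul_of_nonneg_right (hcard N hNA hNs) (Real.exp_pos _).le)

theorem le_withDensity_real_ball {d : ℕ} {f : Rd d → ℝ}
    [IsFiniteMeasure (volume.withDensity fun x => ENNReal.ofReal (f x))] {b ρ : ℝ} {z : Rd d}
    (hb : 0 ≤ b) (hρ : 0 < ρ) (hf : ∀ x ∈ Metric.ball z ρ, b ≤ f x) :
    b * (ρ ^ d * volume.real (Metric.ball (0 : Rd d) 1)) ≤
      (volume.withDensity fun x => ENNReal.ofReal (f x)).real (Metric.ball z ρ) := by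
  have hball : MeasurableSet (Metric.ball z ρ) := Metric.isOpen_ball.measurableSet
  rw [measureReal_def (volume.withDensity _), ← ENNReal.ofReal_le_iff_le_toReal (measure_ne_top _ _),
    withDensity_apply _ hball]
  calc ENNReal.ofReal (b * (ρ ^ d * volume.real (Metric.ball (0 : Rd d) 1)))
      = ENNReal.ofReal b * volume (Metric.ball z ρ) := by
        rw [Measure.addHaar_ball_of_pos _ _ hρ, finrank_euclideanSpace_fin, ENNReal.ofReal_mul hb,
          ENNReal.ofReal_mul (by positivity), ofReal_measureReal]
    _ = ∫⁻ _ in Metric.ball z ρ, ENNReal.ofReal b := by rw [setLIntegral_const]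
    _ ≤ _ := setLIntegral_mono' hball fun x hx => ENNReal.ofReal_le_ofReal (hf x hx)

theorem tendsto_measure_exists_forall_dist_gt {d : ℕ} (hd : 0 < d) {f : Rd d → ℝ} {τ : ℕ → ℝ}
    (hf : UniformContinuous f) (hτ_pos : ∀ n, 0 < τ n) (hτ : Tendsto τ atTop (𝓝 0))
    (hτ_ge : ∀ n : ℕ, (Real.log n ^ 2 / n) ^ (1 / (d : ℝ)) ≤ τ n)
    {Ω : Type*} [MeasurableSpace Ω] {μ : Measure Ω} [IsProbabilityMeasure μ]
    {X : ℕ → Ω → Rd d} (hX : ∀ i, Measurable (X i)) (hind : iIndepFun X μ)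
    (hlaw : ∀ i, μ.map (X i) = volume.withDensity fun x => ENNReal.ofReal (f x))
    {ε : ℝ} (hε : 0 < ε) :
    Tendsto (fun n => μ {ω | ∃ y, ε ≤ f y ∧ ∀ i : Fin n, τ n / 4 < dist (X i ω) y})
      atTop (𝓝 0) := by
  have hP : IsProbabilityMeasure (volume.withDensity fun x => ENNReal.ofReal (f x)) :=
    hlaw 0 ▸ Measure.isProbabilityMeasure_map (hX 0).aemeasurable
  obtain ⟨δ, hδ, hfδ⟩ := Metric.uniformContinuous_iff.1 hf (ε / 2) (by positivity)
  set v := volume.real (Metric.ball (0 : Rd d) 1)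
  have hv : 0 < v := ENNReal.toReal_pos (Metric.measure_ball_pos _ _ one_pos).ne'
    measure_ball_lt_top.ne
  set c := ε / 2 * ((1 / 12) ^ d * v) with hc
  have hc0 : 0 < c := by positivity
  have hlog : Tendsto (fun n : ℕ => Real.log n) atTop atTop :=
    Real.tendsto_log_atTop.comp tendsto_natCast_atTop_atTop
  have hlim : Tendsto (fun n : ℕ => ENNReal.ofReal (Real.log n)⁻¹) atTop (𝓝 0) := by
    simpa using ENNReal.tendsto_ofReal (tendsto_inv_atTop_zero.comp hlog)
  refine tendsto_of_tendsto_of_tendsto_of_le_of_le' tendsto_const_nhds hlim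
    (.of_forall fun _ => zero_le) ?_
  filter_upwards [hτ.eventually_lt_const hδ, hlog.eventually_ge_atTop 1,
    hlog.eventually_ge_atTop c⁻¹, eventually_gt_atTop 0] with n hn₁ hn₂ hn₃ hn₀
  have hnR : (0 : ℝ) < n := Nat.cast_pos.2 hn₀
  have hl0 : 0 < Real.log n := one_pos.trans_le hn₂
  set q := c * (Real.log n ^ 2 / n) with hq
  have hq0 : 0 < q := by positivity
  have hτd : Real.log n ^ 2 / n ≤ τ n ^ d := by
    have h₁ := pow_le_pow_left₀ (by positivity) (hτ_ge n) d
    rwa [one_div, Real.rpow_inv_natCast_pow (by positivity) hd.ne'] at h₁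
  have hmass : ∀ z ∈ {y | ε ≤ f y},
      q ≤ (volume.withDensity fun x => ENNReal.ofReal (f x)).real (Metric.ball z (τ n / 12)) := by
    intro z hz
    rw [Set.mem_ofPred_eq] at hz
    have hτn := hτ_pos n
    refine le_trans ?_ (le_withDensity_real_ball (b := ε / 2) (by positivity)
      (by positivity : 0 < τ n / 12) fun x hx => ?_)
    · calc q ≤ c * τ n ^ d := mul_le_mul_of_nonneg_left hτd hc0.le
        _ = _ := by rw [hc, div_eq_mul_one_div (τ n), mul_pow]; ring
    · rw [Metric.mem_ball] at hx
      have h₁ := hfδ (show dist x z < δ by linarith)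
      rw [Real.dist_eq] at h₁
      linarith [(abs_lt.1 h₁).1]
  -- sample points are found within three times the radius of the balls, so radius `τ n / 12` gives
  -- distance `τ n / 4`
  have hmain := measure_exists_forall_dist_ge_le (A := {y | ε ≤ f y})
    (div_pos (hτ_pos n) (by norm_num : (0 : ℝ) < 12)) hq0 hmass (n := n)
    (X := fun i ω => X i ω) (fun i => hX i) (hind.precomp Fin.val_injective) fun i => hlaw i
  refine (measure_mono ?_).trans (hmain.trans (ENNReal.ofReal_le_ofReal ?_))
  · rintro ω ⟨y, hy, hfar⟩
    exact ⟨y, hy, fun i => by linarith [hfar i]⟩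
  · -- `n q = c log ^ 2 n` is at least `log n`
    have hnq : Real.log n ≤ n * q := by
      have h₁ : 1 ≤ c * Real.log n := by
        rwa [inv_le_iff_one_le_mul₀' hc0] at hn₃
      have h₂ : n * q = c * Real.log n * Real.log n := by rw [hq]; field_simp
      rw [h₂]
      exact le_mul_of_one_le_left hl0.le h₁
    have hexp : Real.exp (-(n * q)) ≤ (n : ℝ)⁻¹ := by
      rw [← Real.exp_log (inv_pos.2 hnR), Real.log_inv, Real.exp_le_exp]
      linarith
    calc q⁻¹ * Real.exp (-(n * q)) ≤ q⁻¹ * (n : ℝ)⁻¹ := by gcongr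
      _ = (n * q)⁻¹ := (mul_inv_rev _ _).symm
      _ ≤ (Real.log n)⁻¹ := by gcongr
/-! ### Consistency of the cluster tree -/

theorem theorem3 {d : ℕ} (hd : 0 < d)
    -- the density: Hölder continuous, with compact support
    (f : Rd d → ℝ) (hf_nonneg : ∀ x, 0 ≤ f x) (hf_supp : HasCompactSupport f)
    (hf_cont : Continuous f)
    (α C : ℝ) (hα_pos : 0 < α) (hα_le : α ≤ 1) (hC : 0 < C)
    (hf_holder : ∀ x ∈ tsupport f, ∀ y ∈ tsupport f, |f x - f y| ≤ C * ‖x - y‖ ^ α)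
    -- the kernel
    (K : Rd d → ℝ) (hK : IsRadialKernel K)
    -- the parameters
    (h τ : ℕ → ℝ) (hh_pos : ∀ n, 0 < h n) (hh : Tendsto h atTop (𝓝 0))
    (hnh : Tendsto (fun n : ℕ => Real.log n / (n * h n ^ d)) atTop (𝓝 0))
    (hτ_pos : ∀ n, 0 < τ n) (hτ : Tendsto τ atTop (𝓝 0))
    (hτ_ge : ∀ n : ℕ, (Real.log n ^ 2 / n) ^ (1 / (d : ℝ)) ≤ τ n)
    -- independent samples with density `f`
    {Ω : Type*} [MeasurableSpace Ω] (μ : Measure Ω) [IsProbabilityMeasure μ]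
    (X : ℕ → Ω → Rd d) (hX_meas : ∀ i, Measurable (X i)) (hX_indep : iIndepFun X μ)
    (hX_law : ∀ i, μ.map (X i) = volume.withDensity fun x => ENNReal.ofReal (f x))
    -- an output of the estimator for each sample size and each outcome
    (T : ℕ → Ω → ℝ → Set (Set (Rd d)))
    (hT : ∀ n ω, IsQuickShiftClusterTree (Set.range (sample X n ω))
      (kde K (h n) n (sample X n ω)) (τ n) (T n ω)) :
    -- convergence in probability, when the estimated tree carries the heights given by `f`, and
    -- when it carries those given by the empirical density
    TendstoInMeasure μ
        (fun n ω => mergeDistortion (Set.range (sample X n ω))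
          (⋃ l : ℝ, clusterTree f l) f (⋃ l > (0 : ℝ), T n ω l) f)
        atTop (fun _ => 0) ∧
      TendstoInMeasure μ
        (fun n ω => mergeDistortion (Set.range (sample X n ω))
          (⋃ l : ℝ, clusterTree f l) f
          (⋃ l > (0 : ℝ), T n ω l) (kde K (h n) n (sample X n ω)))
        atTop (fun _ => 0) := by
  have hf_uc : UniformContinuous f := hf_supp.uniformContinuous_of_continuous hf_cont
  have hgood : ∀ ε : ℝ, 0 < ε → ∀ᶠ n in atTop, ∀ (φ : Ω → Rd d → ℝ), (∀ ω x, 0 ≤ φ ω x) →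
      ∀ ω, (∀ j : Fin n, |φ ω (X j ω) - f (X j ω)| ≤ ε) →
      (∀ j : Fin n, |kde K (h n) n (sample X n ω) (X j ω) - f (X j ω)| ≤ ε) →
      (∀ y, ε ≤ f y → ∃ i : Fin n, dist (X i ω) y ≤ τ n / 4) →
      mergeDistortion (Set.range (sample X n ω)) (⋃ l : ℝ, clusterTree f l) f
        (⋃ l > (0 : ℝ), T n ω l) (φ ω) ≤ 5 * ε := by
    intro ε hε
    obtain ⟨δ, hδ, hfδ⟩ := Metric.uniformContinuous_iff.1 hf_uc ε hε
    filter_upwards [hτ.eventually_lt_const hδ] with n hn φ hφ ω hφf hkde hcov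
    refine mergeDistortion_le hε (hτ_pos n) hf_nonneg (hφ ω) ?_ ?_
      (fun x y hxy => (hfδ (hxy.trans_lt hn)).le) (fun y hy => ?_) (hT n ω)
    · rintro _ ⟨j, rfl⟩
      exact hkde j
    · rintro _ ⟨j, rfl⟩
      exact hφf j
    · obtain ⟨i, hi⟩ := hcov y hy
      exact ⟨X i ω, ⟨i, rfl⟩, hi⟩
  have hmain : ∀ φ : ℕ → Ω → Rd d → ℝ, (∀ n ω x, 0 ≤ φ n ω x) →
      (∀ n ω (j : Fin n), |φ n ω (X j ω) - f (X j ω)| ≤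
        |kde K (h n) n (sample X n ω) (X j ω) - f (X j ω)|) →
      TendstoInMeasure μ (fun n ω => mergeDistortion (Set.range (sample X n ω))
        (⋃ l : ℝ, clusterTree f l) f (⋃ l > (0 : ℝ), T n ω l) (φ n ω)) atTop fun _ => 0 := by
    intro φ hφ hφkde
    rw [tendstoInMeasure_iff_dist]
    intro η hη
    have hε : 0 < η / 6 := by positivity
    have hlim := (tendsto_measure_exists_abs_kde_sub_gt hf_cont hf_nonneg hf_supp hK hh_pos hh hnh
      hX_meas hX_indep hX_law hε).add (tendsto_measure_exists_forall_dist_gt hd hf_uc hτ_pos hτ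
        hτ_ge hX_meas hX_indep hX_law hε)
    rw [add_zero] at hlim
    refine tendsto_of_tendsto_of_tendsto_of_le_of_le' tendsto_const_nhds hlim
      (.of_forall fun _ => zero_le) ?_
    filter_upwards [hgood (η / 6) hε] with n hn
    refine (measure_mono fun ω hω => ?_).trans (measure_union_le _ _)
    rw [Set.mem_ofPred_eq, Real.dist_eq, sub_zero, abs_of_nonneg (mergeDistortion_nonneg _ _ _ _ _)]
      at hω
    by_contra hbad
    rw [Set.mem_union, not_or, Set.mem_ofPred_eq, Set.mem_ofPred_eq] at hbad
    push Not at hbad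
    have := hn (φ n) (hφ n) ω (fun j => (hφkde n ω j).trans (hbad.1 j)) hbad.1 hbad.2
    linarith
  refine ⟨hmain (fun _ _ => f) (fun _ _ => hf_nonneg) (fun _ _ _ => by simp), ?_⟩
  exact hmain (fun n ω => kde K (h n) n (sample X n ω))
    (fun n ω => kde_nonneg hK.nonneg (hh_pos n) n _) fun _ _ _ => le_rfl
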